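/- Let $\gamma\ge 1$, $\mu>0$, $k>0$, let $s\in\mathbb{R}$, $P^\pm>0$ and $J^\pm\in\mathbb{R}$ satisfy the Rankine--Hugoniot conditions $$J^+-J^-=s(P^+-P^-),\qquad \Big(\frac{(J^+)^2}{P^+}+(P^+)^\gamma\Big)-\Big(\frac{(J^-)^2}{P^-}+(P^-)^\gamma\Big)=s(J^+-J^-),$$ and put $A=sP^--J^-$, $B=-sJ^-+\frac{(J^-)^2}{P^-}+(P^-)^\gamma$ and, for $P>0$, $$f(P)=P^\gamma-(As+B)+\frac{A^2}{P},\qquad F(P)=\frac{P^{\gamma+1}}{\gamma+1}-(As+B)P+A^2\ln P .$$ Consider the profile system $$P'=\frac{2}{k^2}\tilde Q,\qquad \tilde Q'=f(P)-\frac{2s\mu}{k^2}\tilde Q+\frac{2}{k^2}\frac{\tilde Q^2}{P}. \tag{1}$$ (i) Let $s>0$ and $P^+<P^-$, and suppose that $F_1(P):=F(P)-\big(\frac{s\mu P}{k}\big)^2-F(P^-)\le 0$ for all $0<P<P^+$. Then (1) has a heteroclinic orbit $(P(y),\tilde Q(y))$, $y\in\mathbb{R}$, with $P>0$, from $[P^-,0]$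 (as $y\to-\infty$) to $[P^+,0]$ (as $y\to+\infty$), and with $J(y)=sP(y)-A$ it gives a traveling wave: $(P,J)(y)\to(P^\pm,J^\pm)$ as $y\to\pm\infty$, and for every $\epsilon>0$ the functions $\rho(t,x)=P\big(\frac{x-st}{\epsilon}\big)$, $m(t,x)=J\big(\frac{x-st}{\epsilon}\big)$ are a classical ($C^3$) solution of $$\rho_t+m_x=0,\qquad m_t+\Big(\frac{m^2}{\rho}+\rho^\gamma\Big)_x=\epsilon\mu\, m_{xx}+\epsilon^2k^2\rho\Big(\frac{(\sqrt\rho)_{xx}}{\sqrt\rho}\Big)_x .$$ If in addition $\frac{s\mu}{k}<\sqrt{-2f'(P^+)}$, then for every such heteroclinic orbit the profile $P$ is non-monotone (neither non-decreasing nor non-increasing on $\mathbb{R}$). (ii) Let $s<0$ and $P^-<P^+$, and suppose that $\tilde F_1(\xi):=F(\xi)-\big(\frac{s\mu\xi}{k}\big)^2-F(P^+)\le 0$ for all $0<\xi<P^-$. Then (1) has a heteroclinic orbit with $P>0$ from $[P^-,0]$ (as $y\to-\infty$) to $[P^+,0]$ (as $y\to+\infty$), which gives a traveling wave as in (i). If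 in addition $-\frac{s\mu}{k}<\sqrt{-2f'(P^-)}$, then for every such heteroclinic orbit the profile $P$ is non-monotone. -/

import Mathlib

open Filter Topology

noncomputable section

namespace QHD

/-- The pair `(ρ, m)` of functions of `(t, x)` is a classical solution with positive density of
the quantum hydrodynamics system with linear viscosity and Bohm potential
`ρ_t + m_x = 0`,
`m_t + (m²/ρ + ρ^γ)_x = ε μ m_xx + ε² k² ρ ((√ρ)_xx / √ρ)_x`. -/
structure IsSolution (γ μ k ε : ℝ) (ρ m : ℝ → ℝ → ℝ) : Prop where
  contDiff_density : ContDiff ℝ 3 (fun z : ℝ × ℝ => ρ z.1 z.2)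
  contDiff_momentum : ContDiff ℝ 3 (fun z : ℝ × ℝ => m z.1 z.2)
  density_pos : ∀ t x, 0 < ρ t x
  mass : ∀ t x, deriv (fun τ => ρ τ x) t + deriv (fun y => m t y) x = 0
  momentum : ∀ t x,
    deriv (fun τ => m τ x) t + deriv (fun y => m t y ^ 2 / ρ t y + ρ t y ^ γ) x
      = ε * μ * iteratedDeriv 2 (fun y => m t y) x
        + ε ^ 2 * k ^ 2 * ρ t x
          * deriv (fun y => iteratedDeriv 2 (fun w => √(ρ t w)) y / √(ρ t y)) x

/-- The Rankine-Hugoniot conditions for the speed `s` and the end states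
`(Pm, Jm)` (at `-∞`) and `(Pp, Jp)` (at `+∞`) of the Euler system with pressure `ρ^γ`. -/
def RankineHugoniot (γ s Pm Jm Pp Jp : ℝ) : Prop :=
  Jp - Jm = s * (Pp - Pm) ∧
  (Jp ^ 2 / Pp + Pp ^ γ) - (Jm ^ 2 / Pm + Pm ^ γ) = s * (Jp - Jm)

/-- The integration constant `A = s P - J` of the mass equation. -/
def constA (s P J : ℝ) : ℝ := s * P - J

/-- The integration constant `B = -s J + J²/P + P^γ` of the momentum equation. -/
def constB (γ s P J : ℝ) : ℝ := -s * J + (J ^ 2 / P + P ^ γ)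

/-- `f(P) = P^γ - (A s + B) + A²/P`. -/
def f (γ s A B P : ℝ) : ℝ := P ^ γ - (A * s + B) + A ^ 2 / P

/-- The antiderivative `F(P) = P^(γ+1)/(γ+1) - (A s + B) P + A² ln P` of `f` on `(0, ∞)`. -/
def F (γ s A B P : ℝ) : ℝ :=
  P ^ (γ + 1) / (γ + 1) - (A * s + B) * P + A ^ 2 * Real.log P

/-- `F(P) - (s μ P / k)² - F(P₀)`: the restriction to the line `Q̃ = s μ P` of the energy
`F(P) - Q̃²/k² - F(P₀)` of the reduced system `P' = 2 Q̃ / k²`, `Q̃' = f(P)`, where `[P₀, 0]` is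
the base point of the homoclinic loop. -/
def F₁ (γ μ k s A B P₀ P : ℝ) : ℝ :=
  F γ s A B P - (s * μ * P / k) ^ 2 - F γ s A B P₀

/-- `(P, Q)` is a heteroclinic orbit, with `P > 0`, of the profile system
`P' = (2/k²) Q`, `Q' = f(P) - (2 s μ / k²) Q + (2/k²) Q²/P`,
from `[Pm, 0]` (as `y → -∞`) to `[Pp, 0]` (as `y → +∞`). -/
structure IsHeteroclinic (γ μ k s A B Pm Pp : ℝ) (P Q : ℝ → ℝ) : Prop where
  pos : ∀ y, 0 < P y
  hasDerivAt_fst : ∀ y, HasDerivAt P (2 / k ^ 2 * Q y) y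
  hasDerivAt_snd : ∀ y, HasDerivAt Q
    (f γ s A B (P y) - 2 * s * μ / k ^ 2 * Q y + 2 / k ^ 2 * (Q y ^ 2 / P y)) y
  tendsto_fst_atBot : Tendsto P atBot (𝓝 Pm)
  tendsto_snd_atBot : Tendsto Q atBot (𝓝 0)
  tendsto_fst_atTop : Tendsto P atTop (𝓝 Pp)
  tendsto_snd_atTop : Tendsto Q atTop (𝓝 0)

/-- `(P, J)` is the profile of a traveling wave with speed `s` connecting the state `(Pm, Jm)` at
`-∞` to the state `(Pp, Jp)` at `+∞`: for every `ε > 0` the functions `ρ = P((x - s t)/ε)`,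
`m = J((x - s t)/ε)` solve the quantum hydrodynamics system. -/
structure IsTravelingWave (γ μ k s Pm Jm Pp Jp : ℝ) (P J : ℝ → ℝ) : Prop where
  isSolution : ∀ ε : ℝ, 0 < ε →
    IsSolution γ μ k ε (fun t x => P ((x - s * t) / ε)) (fun t x => J ((x - s * t) / ε))
  tendsto_density_atBot : Tendsto P atBot (𝓝 Pm)
  tendsto_momentum_atBot : Tendsto J atBot (𝓝 Jm)
  tendsto_density_atTop : Tendsto P atTop (𝓝 Pp)
  tendsto_momentum_atTop : Tendsto J atTop (𝓝 Jp)

end QHD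

end

/-!
# Traveling waves of quantum hydrodynamics with linear viscosity

The profile system is a linearly damped oscillator in disguise. In terms of `w = ln P` it becomes
`w'' + c w' = g(w)` with `c = 2 s μ / k²` and `g(w) = (2 / k²) f(e^w) e^{-w}`: the quadratic term
`Q² / P` is absorbed by the logarithm. By the Rankine-Hugoniot conditions `f` vanishes at both end
states, and since two zeros force `A ≠ 0`, `f` is strictly convex. Hence `g` is negative between the
logarithms `a < b` of the end states and positive to the left of `a`, where it is even bounded below
by a positive constant away from `a`. So the potential energy `-∫ g` has a minimum at `a`, a maximum
at `b`, and an arbitrarily high barrier towards `w = -∞`.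

For `c > 0` the mechanical energy `w'² / 2 - ∫ g` decreases along every orbit, and the heteroclinic
orbit falls from `b` and comes to rest at `a`. It is obtained without an unstable manifold theorem: a
motion released at rest slightly to the left of `b` descends to the midpoint of `(a, b)`
(`exists_descent`), and needs the longer for it the closer to `b` it starts
(`exists_solution_mem_box_Icc`). The velocities at the midpoint have an accumulation point, and the
solution with this velocity comes down from `b`, starting at time `-∞`
(`exists_solution_mem_box_Iic`). Its energy at the midpoint is strictly smaller than the potential
energy at `b`, which confines the orbit to the well, and Barbalat's lemma
(`tendsto_deriv_zero_of_lipschitzWith`) shows that it comes to rest at the only rest point of the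
well (`exists_heteroclinic_of_lipschitzWith`). To have complete flows, the force is first modified
outside a compact interval and the velocity is truncated, at levels that the orbit never exceeds.

An orbit that decreases to `a` monotonically is impossible if `c² < -4 g'(a)`: for large `t` the
function `y = exp(c t / 2) (w - a)` would be nonnegative with `y'' ≤ -κ y`, `κ > 0`
(`not_antitone_of_sq_lt`). This inequality is the condition on `s μ / k`, as
`g'(a) = (2 / k²) f'(e^a)`.

Negative speeds are reduced to positive ones by the reflection `y ↦ -y`, which changes the signs of
`s` and `A` and leaves `f` unchanged (`IsHeteroclinic.reflect`). The partial differential equations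
follow by differentiating the oscillator equation once more (`IsHeteroclinic.isTravelingWave`).
-/

namespace QHD

open Set Metric NNReal

/-! ### Global solutions of ordinary differential equations -/

section GlobalSolutions

variable {E : Type*} [NormedAddCommGroup E] [NormedSpace ℝ E]

/-- Two global solutions of an autonomous equation diverge at most exponentially, in both time
directions. -/
theorem dist_le_mul_exp_abs {V : E → E} {K : ℝ≥0} (hV : LipschitzWith K V) {α β : ℝ → E}
    (hα : ∀ t, HasDerivAt α (V (α t)) t) (hβ : ∀ t, HasDerivAt β (V (β t)) t) (t : ℝ) :
    dist (α t) (β t) ≤ dist (α 0) (β 0) * Real.exp (K * |t|) := by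
  have fwd : ∀ {V : E → E}, LipschitzWith K V → ∀ {α β : ℝ → E},
      (∀ t, HasDerivAt α (V (α t)) t) → (∀ t, HasDerivAt β (V (β t)) t) → ∀ t, 0 ≤ t →
      dist (α t) (β t) ≤ dist (α 0) (β 0) * Real.exp (K * t) := by
    intro V hV α β hα hβ t ht
    have := dist_le_of_trajectories_ODE (v := fun _ => V) (K := K) (a := 0) (b := t)
      (fun _ => hV) (fun s _ => (hα s).continuousAt.continuousWithinAt)
      (fun s _ => (hα s).hasDerivWithinAt) (fun s _ => (hβ s).continuousAt.continuousWithinAt)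
      (fun s _ => (hβ s).hasDerivWithinAt) le_rfl t ⟨ht, le_rfl⟩
    simpa using this
  rcases le_total 0 t with ht | ht
  · simpa [abs_of_nonneg ht] using fwd hV hα hβ t ht
  · -- backwards in time, the reversed curves solve the equation with the field `-V`
    have rev : ∀ {γ : ℝ → E}, (∀ t, HasDerivAt γ (V (γ t)) t) →
        ∀ s, HasDerivAt (fun s => γ (-s)) ((fun x => -V x) (γ (-s))) s := by
      intro γ hγ s
      simpa [Function.comp_def] using (hγ (-s)).scomp s (hasDerivAt_neg s)
    have := fwd (V := fun x => -V x) hV.neg (rev hα) (rev hβ) (-t) (by linarith)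
    simpa [abs_of_nonpos ht] using this

/-- A bounded Lipschitz vector field is complete. -/
theorem exists_forall_hasDerivAt [CompleteSpace E] {V : E → E} {K L : ℝ≥0}
    (hV : LipschitzWith K V) (hL : ∀ x, ‖V x‖ ≤ L) (x₀ : E) :
    ∃ α : ℝ → E, α 0 = x₀ ∧ ∀ t, HasDerivAt α (V (α t)) t := by
  have loc : ∀ n : ℕ, ∃ α : ℝ → E, α 0 = x₀ ∧
      ∀ t ∈ Icc (-(n : ℝ)) n, HasDerivWithinAt α (V (α t)) (Icc (-(n : ℝ)) n) t := by
    intro n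
    have h0 : (0 : ℝ) ∈ Icc (-(n : ℝ)) n := by simp
    have : IsPicardLindelof (fun _ => V) (⟨0, h0⟩ : Icc (-(n : ℝ)) n) x₀ (L * n) 0 L K :=
      { lipschitzOnWith := fun _ _ => hV.lipschitzOnWith
        continuousOn := fun _ _ => continuousOn_const
        norm_le := fun _ _ x _ => hL x
        mul_max_le := by simp }
    exact this.exists_eq_forall_mem_Icc_hasDerivWithinAt₀
  choose α hα0 hα using loc
  have hderiv : ∀ (n : ℕ) (t : ℝ), t ∈ Ioo (-(n : ℝ)) n → HasDerivAt (α n) (V (α n t)) t :=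
    fun n t ht => (hα n t (Ioo_subset_Icc_self ht)).hasDerivAt (Icc_mem_nhds ht.1 ht.2)
  have agree : ∀ m n : ℕ, m ≤ n → ∀ t ∈ Ioo (-(m : ℝ)) m, α m t = α n t := by
    intro m n hmn t ht
    have hmn' : (m : ℝ) ≤ n := by exact_mod_cast hmn
    have hm : (0 : ℝ) < m := by linarith [ht.1, ht.2]
    exact ODE_solution_unique_of_mem_Ioo (v := fun _ => V) (s := fun _ => univ) (t₀ := 0) (K := K)
      (fun _ _ => hV.lipschitzOnWith) ⟨by linarith, hm⟩
      (fun s hs => ⟨hderiv m s hs, mem_univ _⟩)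
      (fun s hs => ⟨hderiv n s ⟨by linarith [hs.1], by linarith [hs.2]⟩, mem_univ _⟩)
      (by rw [hα0, hα0]) ht
  set N : ℝ → ℕ := fun t => ⌊|t|⌋₊ + 1 with hN
  have hNt : ∀ t, |t| < N t := fun t => by
    simpa [hN] using Nat.lt_floor_add_one |t|
  have hglue : ∀ (n : ℕ) (t : ℝ), |t| < n → α (N t) t = α n t := by
    intro n t ht
    rcases le_total (N t) n with h | h
    · exact agree _ _ h t (abs_lt.mp (hNt t))
    · exact (agree _ _ h t (abs_lt.mp ht)).symm
  refine ⟨fun t => α (N t) t, hα0 _, fun t => ?_⟩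
  refine (hderiv (N t) t (abs_lt.mp (hNt t))).congr_of_eventuallyEq ?_
  filter_upwards [(continuous_abs.tendsto t).eventually_lt_const (hNt t)] with s hs
  exact hglue _ _ hs

end GlobalSolutions

/-- A form of Barbalat's lemma: if a function has a limit along a translation invariant filter and
its derivative is Lipschitz, then the derivative tends to zero. -/
theorem tendsto_deriv_zero_of_lipschitzWith {x x' : ℝ → ℝ} {C : ℝ≥0} {L : ℝ} {l : Filter ℝ}
    (hl : ∀ h : ℝ, Tendsto (fun t => t + h) l l) (hx : ∀ t, HasDerivAt x (x' t) t)
    (hC : LipschitzWith C x') (hL : Tendsto x l (𝓝 L)) : Tendsto x' l (𝓝 0) := by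
  rw [Metric.tendsto_nhds]
  intro ε hε
  have hC0 : (0 : ℝ) ≤ C := C.2
  -- the mean value of `x'` over a step `h` differs from `x'` by less than `ε / 2`
  set h : ℝ := ε / (2 * (C + 1)) with hh
  have hpos : 0 < h := by positivity
  have hCh : C * h < ε / 2 := by
    have : h * (2 * (C + 1)) = ε := by rw [hh]; field_simp
    nlinarith
  have hdiff : Tendsto (fun t => x (t + h) - x t) l (𝓝 0) := by
    simpa using (hL.comp (hl h)).sub hL
  filter_upwards [(Metric.tendsto_nhds.mp hdiff) (h * (ε / 2)) (by positivity)] with t ht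
  obtain ⟨ξ, hξ, hξ'⟩ := exists_hasDerivAt_eq_slope x x' (show t < t + h by linarith)
    (fun s _ => (hx s).continuousAt.continuousWithinAt) (fun s _ => hx s)
  have h1 : |x' ξ| < ε / 2 := by
    rw [Real.dist_eq, sub_zero] at ht
    rw [hξ', abs_div, add_sub_cancel_left, abs_of_pos hpos, div_lt_iff₀ hpos]
    linarith
  have h2 : |x' t - x' ξ| ≤ C * h := by
    have := hC.dist_le_mul t ξ
    rw [Real.dist_eq, Real.dist_eq] at this
    refine this.trans (mul_le_mul_of_nonneg_left ?_ hC0)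
    rw [abs_le]
    constructor <;> linarith [hξ.1, hξ.2]
  rw [Real.dist_eq, sub_zero]
  calc |x' t| = |(x' t - x' ξ) + x' ξ| := by ring_nf
    _ ≤ |x' t - x' ξ| + |x' ξ| := abs_add_le _ _
    _ < ε := by linarith

/-! ### The damped oscillator with truncated velocity -/

/-- The truncation of `v` to the interval `[-M, M]`. -/
def clamp (M v : ℝ) : ℝ := max (-M) (min M v)

theorem clamp_of_abs_le {M v : ℝ} (h : |v| ≤ M) : clamp M v = v := by
  rw [abs_le] at h
  rw [clamp, min_eq_right h.2, max_eq_right h.1]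

theorem abs_clamp_le {M : ℝ} (hM : 0 ≤ M) (v : ℝ) : |clamp M v| ≤ M :=
  abs_le.mpr ⟨le_max_left _ _, max_le (by linarith) (min_le_left _ _)⟩

theorem lipschitzWith_clamp (M : ℝ) : LipschitzWith 1 (clamp M) :=
  (LipschitzWith.id.const_min M).const_max (-M)

theorem clamp_neg {M : ℝ} (hM : 0 ≤ M) (v : ℝ) : clamp M (-v) = -clamp M v := by
  unfold clamp
  grind

/-- The phase plane vector field of `w'' + c w' = g(w)`, with the velocity truncated to `[-M, M]`,
which makes the field bounded if `g` is. -/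
def field (g : ℝ → ℝ) (c M : ℝ) (x : ℝ × ℝ) : ℝ × ℝ :=
  (clamp M x.2, g x.1 - c * clamp M x.2)

theorem exists_lipschitzWith_field {g : ℝ → ℝ} {K : ℝ≥0} (hg : LipschitzWith K g) (c M : ℝ) :
    ∃ K' : ℝ≥0, LipschitzWith K' (field g c M) := by
  have h2 : LipschitzWith 1 (fun x : ℝ × ℝ => clamp M x.2) := by
    simpa [Function.comp_def] using
      (lipschitzWith_clamp M).comp (LipschitzWith.prod_snd (α := ℝ) (β := ℝ))
  have h1 : LipschitzWith K (fun x : ℝ × ℝ => g x.1) := by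
    simpa [Function.comp_def] using hg.comp (LipschitzWith.prod_fst (α := ℝ) (β := ℝ))
  have h3 : LipschitzWith ‖c‖₊ (fun x : ℝ × ℝ => c * clamp M x.2) := by
    simpa [Function.comp_def] using (lipschitzWith_smul c).comp h2
  exact ⟨_, h2.prodMk (h1.sub h3)⟩

theorem exists_norm_field_le {g : ℝ → ℝ} {N c M : ℝ} (hN : ∀ x, |g x| ≤ N) (hc : 0 ≤ c)
    (hM : 0 ≤ M) : ∃ L : ℝ≥0, ∀ x, ‖field g c M x‖ ≤ L := by
  refine ⟨⟨max M (N + c * M), hM.trans (le_max_left _ _)⟩, fun x => ?_⟩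
  have h := abs_clamp_le hM x.2
  refine max_le (h.trans (le_max_left _ _)) (le_trans ?_ (le_max_right _ _))
  refine (abs_sub _ _).trans (add_le_add (hN _) ?_)
  rw [abs_mul, abs_of_nonneg hc]
  exact mul_le_mul_of_nonneg_left h hc

/-- Where the velocity reaches the truncation level the damping beats the force, so that the
truncation never becomes active in forward time. -/
theorem abs_le_of_hasDerivAt_clamp {φ v : ℝ → ℝ} {N c M : ℝ}
    (hv : ∀ t, HasDerivAt v (φ t - c * clamp M (v t)) t) (hφ : ∀ t, |φ t| ≤ N) (hNM : N < c * M)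
    (hM : 0 ≤ M) (h0 : |v 0| ≤ M) {t : ℝ} (ht : 0 ≤ t) : |v t| ≤ M := by
  have upper : ∀ {φ v : ℝ → ℝ}, (∀ t, HasDerivAt v (φ t - c * clamp M (v t)) t) →
      (∀ t, |φ t| ≤ N) → |v 0| ≤ M → v t ≤ M := by
    intro φ v hv hφ h0
    refine image_le_of_deriv_right_lt_deriv_boundary (a := 0) (b := t) (B := fun _ => M)
      (B' := fun _ => 0) (fun s _ => (hv s).continuousAt.continuousWithinAt)
      (fun s _ => (hv s).hasDerivWithinAt) (le_of_abs_le h0) (fun s => hasDerivAt_const s M)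
      (fun s _ hs => ?_) ⟨ht, le_rfl⟩
    rw [hs, clamp_of_abs_le (by rw [abs_of_nonneg hM])]
    linarith [le_of_abs_le (hφ s)]
  refine abs_le.mpr ⟨?_, upper hv hφ h0⟩
  have : -v t ≤ M := by
    refine upper (φ := fun t => -φ t) (v := fun t => -v t) (fun s => ?_)
      (fun s => by rw [abs_neg]; exact hφ s) (by rwa [abs_neg])
    refine (hv s).neg.congr_deriv ?_
    rw [clamp_neg hM]
    ring
  linarith

/-- If the force is negative on `(a, b)`, a motion released at rest from a point of `(a, b)`
descends to any lower level of that interval, in finite time and without turning back. -/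
theorem exists_descent {g w v : ℝ → ℝ} {a b c M w₀ : ℝ} (hg : Continuous g)
    (hw : ∀ t, 0 ≤ t → HasDerivAt w (v t) t)
    (hv : ∀ t, 0 ≤ t → HasDerivAt v (g (w t) - c * v t) t)
    (hg_nonpos : ∀ x, a ≤ x → g x ≤ 0) (hg_neg : ∀ x ∈ Ioo a b, g x < 0) (hc : 0 ≤ c)
    (hM : ∀ t, 0 ≤ t → |v t| ≤ M) (hv0 : v 0 = 0) (haw : a < w₀) (hw0 : w₀ < w 0)
    (hwb : w 0 < b) :
    ∃ T, 0 < T ∧ w T = w₀ ∧ ∀ t ∈ Icc 0 T, w t ∈ Icc w₀ b ∧ v t ∈ Icc (-M) 0 := by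
  have hwc : ContinuousOn w (Ici 0) := fun t ht => (hw t ht).continuousAt.continuousWithinAt
  have hvc : ContinuousOn v (Ici 0) := fun t ht => (hv t ht).continuousAt.continuousWithinAt
  -- as long as the motion is above the level `w₀` it moves downwards
  have box : ∀ T, 0 ≤ T → (∀ t ∈ Ico 0 T, w₀ ≤ w t) →
      ∀ t ∈ Icc 0 T, w t ≤ w 0 ∧ v t ≤ 0 := by
    intro T hT h
    have hvneg : ∀ t ∈ Icc 0 T, v t ≤ 0 := by
      have anti : AntitoneOn (fun t => Real.exp (c * t) * v t) (Icc 0 T) := by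
        have hd : ∀ t, 0 ≤ t → HasDerivAt (fun t => Real.exp (c * t) * v t)
            (Real.exp (c * t) * g (w t)) t := by
          intro t ht
          have he : HasDerivAt (fun t => Real.exp (c * t)) (Real.exp (c * t) * c) t := by
            simpa using ((hasDerivAt_id t).const_mul c).exp
          refine (he.mul (hv t ht)).congr_deriv ?_
          ring
        refine antitoneOn_of_hasDerivWithinAt_nonpos (convex_Icc 0 T)
          (fun t ht => (hd t ht.1).continuousAt.continuousWithinAt) (f' := fun t =>
            Real.exp (c * t) * g (w t)) ?_ ?_
        · intro t ht
          rw [interior_Icc] at ht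
          exact (hd t ht.1.le).hasDerivWithinAt
        · intro t ht
          rw [interior_Icc] at ht
          exact mul_nonpos_of_nonneg_of_nonpos (Real.exp_pos _).le
            (hg_nonpos _ (haw.le.trans (h t ⟨ht.1.le, ht.2⟩)))
      intro t ht
      have := anti ⟨le_rfl, hT⟩ ht ht.1
      simp only [hv0, mul_zero] at this
      exact nonpos_of_mul_nonpos_right this (Real.exp_pos _)
    have wanti : AntitoneOn w (Icc 0 T) :=
      antitoneOn_of_hasDerivWithinAt_nonpos (convex_Icc 0 T) (hwc.mono Icc_subset_Ici_self)
        (f' := v)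
        (fun t ht => (hw t (interior_subset ht : t ∈ Icc 0 T).1).hasDerivWithinAt)
        (fun t ht => hvneg t (interior_subset ht))
    exact fun t ht => ⟨wanti ⟨le_rfl, hT⟩ ht ht.1, hvneg t ht⟩
  -- the level `w₀` is reached, since above it the force is bounded away from zero
  have reach : ∃ t, 0 ≤ t ∧ w t ≤ w₀ := by
    by_contra! hcon
    have hb := fun t (ht : 0 ≤ t) => box t ht (fun s hs => (hcon s hs.1).le) t ⟨ht, le_rfl⟩
    obtain ⟨x, hx, hxmax⟩ := isCompact_Icc.exists_isMaxOn
      (nonempty_Icc.mpr hw0.le) hg.continuousOn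
    have hη : g x < 0 := hg_neg x ⟨haw.trans_le hx.1, hx.2.trans_lt hwb⟩
    have lin : ∀ t, 0 ≤ t → v t + c * w t ≤ c * w 0 + g x * t := by
      intro t ht
      have := (convex_Icc 0 t).image_sub_le_mul_sub_of_deriv_le
        (f := fun t => v t + c * w t) (C := g x)
        ((hvc.mono Icc_subset_Ici_self).add
          (continuousOn_const.mul (hwc.mono Icc_subset_Ici_self)))
        (fun s hs => ((hv s (interior_subset hs : s ∈ Icc 0 t).1).add
          ((hw s (interior_subset hs : s ∈ Icc 0 t).1).const_mul c)).differentiableAt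
            |>.differentiableWithinAt)
        (fun s hs => by
          have hs0 := (interior_subset hs : s ∈ Icc 0 t).1
          have hd : HasDerivAt (fun t => v t + c * w t) (g (w s)) s :=
            ((hv s hs0).add ((hw s hs0).const_mul c)).congr_deriv (sub_add_cancel _ _)
          rw [hd.deriv]
          exact hxmax ⟨(hcon s hs0).le, (hb s hs0).1⟩)
        0 ⟨le_rfl, ht⟩ t ⟨ht, le_rfl⟩ ht
      simp only [hv0] at this
      linarith
    set t := (M + c * (w 0 - w₀) + 1) / (-g x) with htdef
    have hM0 : 0 ≤ M := (abs_nonneg _).trans (hM 0 le_rfl)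
    have hcw : 0 ≤ c * (w 0 - w₀) := mul_nonneg hc (by linarith)
    have ht : 0 ≤ t := div_nonneg (by linarith) (by linarith)
    have htg : g x * t = -(M + c * (w 0 - w₀) + 1) := by
      rw [htdef]; field_simp [hη.ne]
    have h1 := lin t ht
    rw [htg] at h1
    have h2 := (abs_le.mp (hM t ht)).1
    have h3 : c * w₀ ≤ c * w t := mul_le_mul_of_nonneg_left (hcon t ht).le hc
    linarith
  -- the first time at which the level is reached
  obtain ⟨t₁, ht₁, hwt₁⟩ := reach
  set S : Set ℝ := Ici 0 ∩ w ⁻¹' Iic w₀ with hS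
  have hSc : IsClosed S := hwc.preimage_isClosed_of_isClosed isClosed_Ici isClosed_Iic
  have hSb : BddBelow S := ⟨0, fun t ht => ht.1⟩
  have hT := hSc.csInf_mem ⟨t₁, ht₁, hwt₁⟩ hSb
  set T := sInf S with hTdef
  have hT0 : 0 ≤ T := hT.1
  have hTw : w T ≤ w₀ := hT.2
  have habove : ∀ t ∈ Ico 0 T, w₀ ≤ w t := by
    intro t ht
    by_contra! hlt
    exact absurd (csInf_le hSb ⟨ht.1, hlt.le⟩) (not_le.mpr ht.2)
  have hTpos : 0 < T := by
    rcases hT0.eq_or_lt with h | h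
    · rw [← h] at hTw; exact absurd hTw (not_le.mpr hw0)
    · exact h
  have hTeq : w T = w₀ := by
    refine le_antisymm hTw ?_
    refine ge_of_tendsto ((hw T hT0).continuousAt.tendsto.mono_left
      (nhdsWithin_le_nhds (s := Iio T))) ?_
    filter_upwards [Ico_mem_nhdsLT hTpos] with t ht using habove t ht
  refine ⟨T, hTpos, hTeq, fun t ht => ?_⟩
  obtain ⟨h1, h2⟩ := box T hT0 habove t ht
  refine ⟨⟨?_, h1.trans hwb.le⟩, (abs_le.mp (hM t ht.1)).1, h2⟩
  rcases ht.2.eq_or_lt with h | h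
  · rw [h, hTeq]
  · exact habove t ⟨ht.1, h⟩

/-! ### The heteroclinic orbit of the damped oscillator -/

/-- Released at rest close enough to the equilibrium `b`, a motion takes at least the time `τ` to
descend to the level `w₀`, because it stays near the equilibrium by continuous dependence on the
initial data. Time is counted from the passage at `w₀`. -/
theorem exists_solution_mem_box_Icc {g : ℝ → ℝ} {K : ℝ≥0} {N c M a b w₀ τ : ℝ}
    (hg : LipschitzWith K g) (hN : ∀ x, |g x| ≤ N) (hc : 0 < c) (hM : 0 ≤ M) (hNM : N < c * M)
    (hg_nonpos : ∀ x, a ≤ x → g x ≤ 0) (hg_neg : ∀ x ∈ Ioo a b, g x < 0) (hgb : g b = 0)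
    (haw : a < w₀) (hwb : w₀ < b) (hτ : 0 ≤ τ) :
    ∃ α : ℝ → ℝ × ℝ, (∀ t, HasDerivAt α (field g c M (α t)) t) ∧ (α 0).1 = w₀ ∧
      ∀ t ∈ Icc (-τ) 0, α t ∈ Icc w₀ b ×ˢ Icc (-M) 0 := by
  obtain ⟨K', hK'⟩ := exists_lipschitzWith_field hg c M
  obtain ⟨L, hL⟩ := exists_norm_field_le hN hc.le hM
  set δ : ℝ := (b - w₀) / 2 * Real.exp (-(K' * τ)) with hδ
  have hδ0 : 0 < δ := by have : 0 < b - w₀ := by linarith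
                         positivity
  have hδexp : δ * Real.exp (K' * τ) = (b - w₀) / 2 := by
    rw [hδ, mul_assoc, ← Real.exp_add]; simp
  have hδlt : δ < b - w₀ := by
    have : Real.exp (-(K' * τ)) ≤ 1 := Real.exp_le_one_iff.mpr (by
      have := mul_nonneg K'.2 hτ
      simpa using this)
    nlinarith
  obtain ⟨α, hα0, hα⟩ := exists_forall_hasDerivAt hK' hL (b - δ, 0)
  have hα1 : ∀ t, HasDerivAt (fun t => (α t).1) (clamp M (α t).2) t := fun t => (hα t).fst
  have hα2 : ∀ t, HasDerivAt (fun t => (α t).2) (g (α t).1 - c * clamp M (α t).2) t :=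
    fun t => (hα t).snd
  have hv : ∀ t, 0 ≤ t → |(α t).2| ≤ M := fun t ht =>
    abs_le_of_hasDerivAt_clamp (φ := fun t => g (α t).1) (v := fun t => (α t).2) hα2
      (fun t => hN _) hNM hM (by simpa [hα0] using hM) ht
  obtain ⟨T, hT0, hTw, hT⟩ := exists_descent (w := fun t => (α t).1) (v := fun t => (α t).2)
    (a := a) (b := b) (c := c) (M := M) (w₀ := w₀) hg.continuous
    (fun t ht => by simpa [clamp_of_abs_le (hv t ht)] using hα1 t)
    (fun t ht => by simpa [clamp_of_abs_le (hv t ht)] using hα2 t)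
    hg_nonpos hg_neg hc.le hv (by simp [hα0]) haw (by simp only [hα0]; linarith)
    (by simp only [hα0]; linarith)
  have hτT : τ ≤ T := by
    by_contra! hlt
    have hzero : field g c M (b, 0) = 0 := by
      have : clamp M 0 = 0 := clamp_of_abs_le (by simpa using hM)
      simp [field, this, hgb]
    have hd := dist_le_mul_exp_abs hK' hα (β := fun _ => ((b, 0) : ℝ × ℝ))
      (fun t => by rw [hzero]; exact hasDerivAt_const t _) T
    have h1 : dist (α 0) ((b, 0) : ℝ × ℝ) = δ := by
      rw [hα0, Prod.dist_eq, Real.dist_eq, dist_self]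
      simp [abs_of_pos hδ0, hδ0.le]
    have h2 : b - w₀ ≤ dist (α T) ((b, 0) : ℝ × ℝ) := by
      rw [Prod.dist_eq]
      refine le_trans ?_ (le_max_left _ _)
      rw [hTw, Real.dist_eq, abs_sub_comm]
      exact le_abs_self _
    have h3 : δ * Real.exp (K' * |T|) ≤ (b - w₀) / 2 := by
      rw [← hδexp, abs_of_pos hT0]
      gcongr
    rw [h1] at hd
    linarith
  refine ⟨fun t => α (t + T), fun t => ?_, by simpa using hTw, fun t ht => ?_⟩
  · exact (hα (t + T)).comp_add_const t T
  · exact hT (t + T) ⟨by linarith [ht.1], by linarith [ht.2]⟩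

/-- A limit of motions that take longer and longer to descend to the level `w₀`: a solution through
that level whose whole past is a descent from above. -/
theorem exists_solution_mem_box_Iic {g : ℝ → ℝ} {K : ℝ≥0} {N c M a b w₀ : ℝ}
    (hg : LipschitzWith K g) (hN : ∀ x, |g x| ≤ N) (hc : 0 < c) (hM : 0 ≤ M) (hNM : N < c * M)
    (hg_nonpos : ∀ x, a ≤ x → g x ≤ 0) (hg_neg : ∀ x ∈ Ioo a b, g x < 0) (hgb : g b = 0)
    (haw : a < w₀) (hwb : w₀ < b) :
    ∃ α : ℝ → ℝ × ℝ, (∀ t, HasDerivAt α (field g c M (α t)) t) ∧ (α 0).1 = w₀ ∧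
      ∀ t ≤ 0, α t ∈ Icc w₀ b ×ˢ Icc (-M) 0 := by
  obtain ⟨K', hK'⟩ := exists_lipschitzWith_field hg c M
  obtain ⟨L, hL⟩ := exists_norm_field_le hN hc.le hM
  choose β hβ hβ0 hβbox using fun n : ℕ =>
    exists_solution_mem_box_Icc hg hN hc hM hNM hg_nonpos hg_neg hgb haw hwb (Nat.cast_nonneg n)
  have hmem : ∀ n, β n 0 ∈ Icc w₀ b ×ˢ Icc (-M) 0 := fun n => hβbox n 0 (by simp)
  obtain ⟨x, -, φ, hφ, hx⟩ := (isCompact_Icc.prod isCompact_Icc).tendsto_subseq hmem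
  obtain ⟨α, hα0, hα⟩ := exists_forall_hasDerivAt hK' hL x
  have hconv : ∀ t, Tendsto (fun n => β (φ n) t) atTop (𝓝 (α t)) := by
    intro t
    rw [tendsto_iff_dist_tendsto_zero] at hx ⊢
    have := hx.mul_const (Real.exp (K' * |t|))
    rw [zero_mul] at this
    refine squeeze_zero (fun _ => dist_nonneg) (fun n => ?_) this
    have := dist_le_mul_exp_abs hK' (hβ (φ n)) hα t
    rwa [hα0] at this
  refine ⟨α, hα, ?_, fun t ht => ?_⟩
  · refine tendsto_nhds_unique ((continuous_fst.tendsto _).comp (hconv 0)) ?_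
    simp [Function.comp_def, hβ0]
  · refine (isClosed_Icc.prod isClosed_Icc).mem_of_tendsto (hconv t) ?_
    filter_upwards [eventually_ge_atTop ⌈-t⌉₊] with n hn
    refine hβbox _ t ⟨?_, ht⟩
    have h1 : (⌈-t⌉₊ : ℝ) ≤ φ n := by exact_mod_cast hn.trans (hφ.id_le n)
    linarith [Nat.le_ceil (-t)]

/-- **Heteroclinic orbit of the damped oscillator**, for a bounded Lipschitz force `g` with
potential energy `-G`: there is a motion from the maximum point `b` of the potential energy to its
minimum point `a`, confined by the barrier at `l`. -/
theorem exists_heteroclinic_of_lipschitzWith {g G : ℝ → ℝ} {K : ℝ≥0} {N c l a b : ℝ}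
    (hg : LipschitzWith K g) (hN : ∀ x, |g x| ≤ N) (hG : ∀ x, HasDerivAt G (g x) x) (hc : 0 < c)
    (hla : l < a) (hab : a < b) (hlb : G l ≤ G b) (hg_nonpos : ∀ x, a ≤ x → g x ≤ 0)
    (hg_neg : ∀ x ∈ Ioo a b, g x < 0) (hg_pos : ∀ x, x < a → 0 < g x) (hgb : g b = 0) :
    ∃ w v : ℝ → ℝ, (∀ t, HasDerivAt w (v t) t) ∧ (∀ t, HasDerivAt v (g (w t) - c * v t) t) ∧
      (∀ t, w t ∈ Icc l b) ∧ Tendsto w atBot (𝓝 b) ∧ Tendsto v atBot (𝓝 0) ∧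
      Tendsto w atTop (𝓝 a) ∧ Tendsto v atTop (𝓝 0) := by
  have hN0 : 0 ≤ N := (abs_nonneg _).trans (hN 0)
  set M : ℝ := (N + 1) / c with hMdef
  have hM : 0 ≤ M := by positivity
  have hNM : N < c * M := by rw [hMdef]; field_simp; linarith
  set w₀ : ℝ := (a + b) / 2 with hw₀
  have haw : a < w₀ := by linarith
  have hwb : w₀ < b := by linarith
  obtain ⟨α, hα, hα0, hbox⟩ := exists_solution_mem_box_Iic hg hN hc hM hNM hg_nonpos hg_neg hgb
    haw hwb
  set w : ℝ → ℝ := fun t => (α t).1 with hwdef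
  set v : ℝ → ℝ := fun t => (α t).2 with hvdef
  have hw0 : w 0 = w₀ := hα0
  have hvM : ∀ t, |v t| ≤ M := by
    have h0 : ∀ t ≤ 0, |v t| ≤ M := fun t ht =>
      abs_le.mpr ⟨(hbox t ht).2.1, (hbox t ht).2.2.trans hM⟩
    intro t
    rcases le_total t 0 with ht | ht
    · exact h0 t ht
    · exact abs_le_of_hasDerivAt_clamp (φ := fun t => g (w t)) (fun t => (hα t).snd)
        (fun t => hN _) hNM hM (h0 0 le_rfl) ht
  have hw : ∀ t, HasDerivAt w (v t) t := fun t =>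
    HasDerivAt.congr_deriv (f' := clamp M (v t)) (hα t).fst (clamp_of_abs_le (hvM t))
  have hv : ∀ t, HasDerivAt v (g (w t) - c * v t) t := fun t =>
    HasDerivAt.congr_deriv (f' := g (w t) - c * clamp M (v t)) (hα t).snd
      (congrArg (fun u => g (w t) - c * u) (clamp_of_abs_le (hvM t)))
  have hwc : Continuous w := continuous_iff_continuousAt.mpr fun t => (hw t).continuousAt
  have hGc : Continuous G := continuous_iff_continuousAt.mpr fun t => (hG t).continuousAt
  -- all derivatives in sight are Lipschitz
  have hwL : LipschitzWith ⟨M, hM⟩ w := lipschitzWith_of_nnnorm_deriv_le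
    (fun t => (hw t).differentiableAt) fun t => by rw [(hw t).deriv]; exact hvM t
  have hvL : LipschitzWith ⟨N + c * M, by positivity⟩ v := lipschitzWith_of_nnnorm_deriv_le
    (fun t => (hv t).differentiableAt) fun t => by
      rw [(hv t).deriv]
      refine (abs_sub _ _).trans (add_le_add (hN _) ?_)
      rw [abs_mul, abs_of_pos hc]
      exact mul_le_mul_of_nonneg_left (hvM t) hc.le
  have hv'L : ∃ C : ℝ≥0, LipschitzWith C (fun t => g (w t) - c * v t) :=
    ⟨_, (hg.comp hwL).sub ((lipschitzWith_smul c).comp hvL)⟩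
  obtain ⟨C', hC'⟩ := hv'L
  -- the mechanical energy
  set e : ℝ → ℝ := fun t => v t ^ 2 / 2 - G (w t) with hedef
  have he : ∀ t, HasDerivAt e (-c * v t ^ 2) t := fun t => by
    refine ((((hv t).pow 2).div_const 2).sub ((hG (w t)).comp t (hw t))).congr_deriv ?_
    simp only [Nat.cast_ofNat]
    ring
  have heanti : Antitone e := antitone_of_hasDerivAt_nonpos he fun t => by
    have := mul_nonneg hc.le (sq_nonneg (v t))
    show -c * v t ^ 2 ≤ 0
    linarith
  -- the past of the orbit
  have hwanti : AntitoneOn w (Iic 0) :=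
    antitoneOn_of_hasDerivWithinAt_nonpos (convex_Iic 0) hwc.continuousOn (f' := v)
      (fun t _ => (hw t).hasDerivWithinAt)
      (fun t ht => (hbox t (interior_subset ht : t ∈ Iic (0 : ℝ))).2.2)
  have hbot : ∀ h : ℝ, Tendsto (fun t => t + h) atBot atBot :=
    fun h => tendsto_atBot_add_const_right _ h tendsto_id
  have htop : ∀ h : ℝ, Tendsto (fun t => t + h) atTop atTop :=
    fun h => tendsto_atTop_add_const_right _ h tendsto_id
  obtain ⟨W, hW⟩ : ∃ W, Tendsto w atBot (𝓝 W) := by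
    have hmin : Antitone (fun t => w (min t 0)) := fun s t hst =>
      hwanti (mem_Iic.mpr (min_le_right _ _)) (mem_Iic.mpr (min_le_right _ _))
        (min_le_min_right _ hst)
    have := tendsto_atBot_ciSup hmin ⟨b, by
      rintro _ ⟨t, rfl⟩
      exact (hbox _ (min_le_right _ _)).1.2⟩
    refine ⟨_, this.congr' ?_⟩
    filter_upwards [eventually_le_atBot 0] with t ht
    rw [min_eq_left ht]
  have hvbot : Tendsto v atBot (𝓝 0) := tendsto_deriv_zero_of_lipschitzWith hbot hw hvL hW
  have hWb : W = b := by
    have h0 := tendsto_deriv_zero_of_lipschitzWith hbot hv hC' hvbot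
    have h1 : Tendsto (fun t => g (w t) - c * v t) atBot (𝓝 (g W - c * 0)) :=
      ((hg.continuous.tendsto W).comp hW).sub (hvbot.const_mul c)
    have hgW : g W = 0 := by
      have := tendsto_nhds_unique h1 h0
      simpa using this
    have hWmem : W ∈ Icc w₀ b := isClosed_Icc.mem_of_tendsto hW (by
      filter_upwards [eventually_le_atBot 0] with t ht using (hbox t ht).1)
    by_contra hne
    exact (hg_neg W ⟨haw.trans_le hWmem.1, lt_of_le_of_ne hWmem.2 hne⟩).ne hgW
  rw [hWb] at hW
  -- the orbit starts with the energy of the equilibrium `b` and has lost some of it at time `0`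
  have hebot : Tendsto e atBot (𝓝 (-G b)) := by
    have := ((hvbot.pow 2).div_const 2).sub ((hGc.tendsto b).comp hW)
    simpa using this
  have hele : ∀ t, e t ≤ -G b := fun t => heanti.ge_of_tendsto hebot t
  have he0 : e 0 < -G b := by
    refine lt_of_le_of_ne (hele 0) fun heq => ?_
    have hconst : ∀ t ≤ 0, e t = -G b := fun t ht =>
      le_antisymm (hele t) (heq ▸ heanti ht)
    have hv0 : ∀ t < 0, v t = 0 := by
      intro t ht
      have hz : HasDerivAt e 0 t := (hasDerivAt_const t (-G b)).congr_of_eventuallyEq (by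
        filter_upwards [Iio_mem_nhds ht] with s hs using hconst s (le_of_lt hs))
      have := (he t).unique hz
      simpa [hc.ne'] using this
    have hwconst : ∀ t ≤ 0, w t = w₀ := by
      intro t ht
      have hmono : MonotoneOn w (Iic 0) :=
        monotoneOn_of_hasDerivWithinAt_nonneg (convex_Iic 0) hwc.continuousOn (f' := v)
          (fun t _ => (hw t).hasDerivWithinAt)
          (fun t ht => by rw [interior_Iic] at ht; exact (hv0 t ht).ge)
      rw [← hw0]
      exact le_antisymm (hmono ht (le_refl (0 : ℝ)) ht) (hwanti ht (le_refl (0 : ℝ)) ht)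
    have : Tendsto w atBot (𝓝 w₀) := tendsto_const_nhds.congr' (by
      filter_upwards [eventually_le_atBot 0] with t ht using (hwconst t ht).symm)
    exact hwb.ne (tendsto_nhds_unique this hW)
  -- from then on the energy barrier confines the orbit
  have hGw : ∀ t, 0 ≤ t → G b < G (w t) := by
    intro t ht
    have h1 : e t ≤ e 0 := heanti ht
    have h2 : 0 ≤ v t ^ 2 / 2 := by positivity
    have h3 : e t = v t ^ 2 / 2 - G (w t) := rfl
    linarith
  have hfwd : ∀ t, 0 ≤ t → w t ∈ Ioo l b := by
    have hpre : IsPreconnected (w '' Ici 0) := isPreconnected_Ici.image _ hwc.continuousOn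
    have h0mem : w₀ ∈ w '' Ici 0 := ⟨0, le_refl (0 : ℝ), hw0⟩
    intro t ht
    have htmem : w t ∈ w '' Ici 0 := ⟨t, ht, rfl⟩
    constructor
    · by_contra! hle
      obtain ⟨s, hs, hsl⟩ := hpre.Icc_subset htmem h0mem ⟨hle, (hla.trans haw).le⟩
      have := hGw s hs
      rw [hsl] at this
      linarith
    · by_contra! hle
      obtain ⟨s, hs, hsb⟩ := hpre.Icc_subset h0mem htmem ⟨hwb.le, hle⟩
      have := hGw s hs
      rw [hsb] at this
      linarith
  have hmem : ∀ t, w t ∈ Icc l b := by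
    intro t
    rcases le_total t 0 with ht | ht
    · exact ⟨(hla.trans haw).le.trans (hbox t ht).1.1, (hbox t ht).1.2⟩
    · exact Ioo_subset_Icc_self (hfwd t ht)
  -- the future of the orbit: the dissipation of energy, and with it the motion, dies out
  have hetop : ∃ L, Tendsto e atTop (𝓝 L) := by
    obtain ⟨x, -, hx⟩ := isCompact_Icc.exists_isMaxOn (nonempty_Icc.mpr (hla.trans hab).le)
      hGc.continuousOn
    refine ⟨_, tendsto_atTop_ciInf heanti ⟨-G x, ?_⟩⟩
    rintro _ ⟨t, rfl⟩
    have h1 : G (w t) ≤ G x := hx (hmem t)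
    have h2 : 0 ≤ v t ^ 2 / 2 := by positivity
    show -G x ≤ v t ^ 2 / 2 - G (w t)
    linarith
  obtain ⟨L, hL⟩ := hetop
  have he'L : ∃ C : ℝ≥0, LipschitzWith C (fun t => -c * v t ^ 2) := by
    have hd : ∀ t, HasDerivAt (fun t => -c * v t ^ 2) (-c * (2 * v t * (g (w t) - c * v t))) t :=
      fun t => (((hv t).pow 2).const_mul (-c)).congr_deriv (by simp)
    refine ⟨Real.toNNReal (c * (2 * M * (N + c * M))), lipschitzWith_of_nnnorm_deriv_le
      (fun t => (hd t).differentiableAt) fun t => ?_⟩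
    rw [(hd t).deriv, ← NNReal.coe_le_coe, coe_nnnorm, Real.norm_eq_abs,
      Real.coe_toNNReal _ (by positivity)]
    have h1 : |g (w t) - c * v t| ≤ N + c * M := by
      refine (abs_sub _ _).trans (add_le_add (hN _) ?_)
      rw [abs_mul, abs_of_pos hc]
      exact mul_le_mul_of_nonneg_left (hvM t) hc.le
    rw [abs_mul, abs_neg, abs_of_pos hc, abs_mul, abs_mul, abs_two]
    have := hvM t
    gcongr
  obtain ⟨C, hC⟩ := he'L
  have hvtop : Tendsto v atTop (𝓝 0) := by
    have h := (tendsto_deriv_zero_of_lipschitzWith htop he hC hL).const_mul (-c)⁻¹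
    have h2 : Tendsto (fun t => v t ^ 2) atTop (𝓝 0) := by
      simpa [← mul_assoc, hc.ne'] using h
    have h3 := (Real.continuous_sqrt.tendsto 0).comp h2
    rw [Real.sqrt_zero] at h3
    refine tendsto_zero_iff_abs_tendsto_zero _ |>.mpr (h3.congr fun t => ?_)
    exact Real.sqrt_sq_eq_abs (v t)
  have hgtop : Tendsto (fun t => g (w t)) atTop (𝓝 0) := by
    have h := (tendsto_deriv_zero_of_lipschitzWith htop hv hC' hvtop).add (hvtop.const_mul c)
    simpa using h
  refine ⟨w, v, hw, hv, hmem, hW, hvbot, ?_, hvtop⟩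
  refine isCompact_Icc.tendsto_nhds_of_unique_mapClusterPt (Eventually.of_forall hmem) ?_
  intro x hx hcl
  have hgx : g x = 0 := by
    have h1 : MapClusterPt (g x) atTop (fun t => g (w t)) :=
      hcl.continuousAt_comp hg.continuous.continuousAt
    exact eq_of_nhds_neBot (h1.neBot.mono (inf_le_inf_left _ hgtop))
  have hGx : G b < G x := by
    have h1 : MapClusterPt (G x) atTop (fun t => G (w t)) :=
      hcl.continuousAt_comp hGc.continuousAt
    have h2 : G x ∈ Ici (-e 0) := isClosed_Ici.mem_of_mapClusterPt h1 (by
      filter_upwards [eventually_ge_atTop 0] with t ht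
      have h3 : v t ^ 2 / 2 - G (w t) ≤ e 0 := heanti ht
      have h4 : 0 ≤ v t ^ 2 / 2 := by positivity
      show -e 0 ≤ G (w t)
      linarith)
    have h3 : -e 0 ≤ G x := h2
    linarith
  rcases lt_trichotomy x a with h | h | h
  · exact absurd hgx (hg_pos x h).ne'
  · exact h
  · rcases hx.2.eq_or_lt with h' | h'
    · exact absurd hGx (by rw [h']; exact lt_irrefl _)
    · exact absurd hgx (hg_neg x ⟨h, h'⟩).ne

/-- **Heteroclinic orbit of the damped oscillator** `w'' + c w' = g(w)`. The force need only be
bounded below by a positive constant far to the left, which makes the potential energy barrier there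
higher than its value at `b`. -/
theorem exists_heteroclinic {g : ℝ → ℝ} {c a b x₁ η : ℝ} (hg : ContDiff ℝ 1 g) (hc : 0 < c)
    (hab : a < b) (hg_neg : ∀ x ∈ Ioo a b, g x < 0) (hg_pos : ∀ x, x < a → 0 < g x)
    (hga : g a = 0) (hgb : g b = 0) (hx₁ : x₁ < a) (hη : 0 < η) (hgη : ∀ x ≤ x₁, η ≤ g x) :
    ∃ w v : ℝ → ℝ, (∀ t, HasDerivAt w (v t) t) ∧ (∀ t, HasDerivAt v (g (w t) - c * v t) t) ∧
      Tendsto w atBot (𝓝 b) ∧ Tendsto v atBot (𝓝 0) ∧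
      Tendsto w atTop (𝓝 a) ∧ Tendsto v atTop (𝓝 0) := by
  have hG : ∀ x, HasDerivAt (fun x => ∫ y in b..x, g y) (g x) x := fun x =>
    hg.continuous.integral_hasStrictDerivAt b x |>.hasDerivAt
  set G : ℝ → ℝ := fun x => ∫ y in b..x, g y with hGdef
  -- the barrier
  set l : ℝ := x₁ - |G x₁| / η with hl
  have hlx : l ≤ x₁ := by
    have : 0 ≤ |G x₁| / η := by positivity
    linarith
  have hGl : G l ≤ 0 := by
    have := (convex_Icc l x₁).mul_sub_le_image_sub_of_le_deriv (f := G) (C := η)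
      (fun t _ => (hG t).continuousAt.continuousWithinAt)
      (fun t _ => (hG t).differentiableAt.differentiableWithinAt)
      (fun t ht => by
        rw [(hG t).deriv]
        exact hgη t (interior_subset ht : t ∈ Icc l x₁).2)
      l ⟨le_rfl, hlx⟩ x₁ ⟨hlx, le_rfl⟩ hlx
    have h2 : η * (x₁ - l) = |G x₁| := by rw [hl]; field_simp; ring
    linarith [le_abs_self (G x₁)]
  have hla : l < a := hlx.trans_lt hx₁
  have hlb : l ≤ b := (hla.trans hab).le
  -- the force is modified outside `[l, b]`, where the orbit never goes
  obtain ⟨K, hK⟩ := hg.contDiffOn.exists_lipschitzOnWith one_ne_zero (convex_Icc l b) isCompact_Icc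
  obtain ⟨N, hN⟩ := isCompact_Icc.exists_bound_of_continuousOn
    (s := Icc l b) hg.continuous.continuousOn
  set h : ℝ → ℝ := (Icc l b).domRestrict g ∘ projIcc l b hlb with hh
  have hhL : LipschitzWith (K * 1) h := hK.to_restrict.comp (LipschitzWith.projIcc hlb)
  have hhg : ∀ x ∈ Icc l b, h x = g x := fun x hx => by simp [hh, projIcc_of_mem hlb hx]
  have hhb : ∀ x, b ≤ x → h x = 0 := fun x hx => by simp [hh, projIcc_of_right_le hlb hx, hgb]
  have hhl : ∀ x, x ≤ l → h x = g l := fun x hx => by simp [hh, projIcc_of_le_left hlb hx]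
  have hbarrier : ∫ y in b..l, h y ≤ ∫ y in b..b, h y := by
    rw [intervalIntegral.integral_same]
    refine le_of_eq_of_le (intervalIntegral.integral_congr fun x hx => ?_) hGl
    rw [uIcc_of_ge hlb] at hx
    exact hhg x hx
  have hh_nonpos : ∀ x, a ≤ x → h x ≤ 0 := by
    intro x hx
    rcases lt_or_ge x b with hxb | hxb
    · rw [hhg x ⟨hla.le.trans hx, hxb.le⟩]
      rcases hx.eq_or_lt with rfl | hax
      · exact hga.le
      · exact (hg_neg x ⟨hax, hxb⟩).le
    · exact (hhb x hxb).le
  have hh_neg : ∀ x ∈ Ioo a b, h x < 0 := by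
    intro x hx
    rw [hhg x ⟨(hla.trans hx.1).le, hx.2.le⟩]
    exact hg_neg x hx
  have hh_pos : ∀ x, x < a → 0 < h x := by
    intro x hx
    rcases le_total x l with hxl | hxl
    · rw [hhl x hxl]; exact hg_pos l hla
    · rw [hhg x ⟨hxl, (hx.trans hab).le⟩]; exact hg_pos x hx
  obtain ⟨w, v, hw, hv, hmem, h1, h2, h3, h4⟩ := exists_heteroclinic_of_lipschitzWith
    (G := fun x => ∫ y in b..x, h y) hhL (fun x => hN _ (projIcc l b hlb x).2)
    (fun x => (hhL.continuous.integral_hasStrictDerivAt b x).hasDerivAt) hc hla hab hbarrier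
    hh_nonpos hh_neg hh_pos (hhb b le_rfl)
  exact ⟨w, v, hw, fun t => by rw [← hhg _ (hmem t)]; exact hv t, h1, h2, h3, h4⟩

/-! ### Oscillation around a focus -/

/-- A nonnegative function that is positive at the left end of a half-line cannot satisfy
`y'' ≤ -κ y`, `κ > 0`, there: being concave and bounded below it increases, and then `y''` stays below
a negative constant. -/
theorem false_of_deriv_deriv_le_neg_mul {y y' y'' : ℝ → ℝ} {κ t₁ : ℝ} (hκ : 0 < κ)
    (hy : ∀ t, HasDerivAt y (y' t) t) (hy' : ∀ t, HasDerivAt y' (y'' t) t)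
    (hpos : ∀ t, t₁ ≤ t → 0 ≤ y t) (h₁ : 0 < y t₁) (hle : ∀ t, t₁ ≤ t → y'' t ≤ -(κ * y t)) :
    False := by
  have mvt : ∀ {f f' : ℝ → ℝ} {C s t : ℝ}, (∀ t, HasDerivAt f (f' t) t) →
      (∀ r, s ≤ r → f' r ≤ C) → s ≤ t → f t ≤ f s + C * (t - s) := by
    intro f f' C s t hf hC hst
    have := (convex_Ici s).image_sub_le_mul_sub_of_deriv_le (f := f) (C := C)
      (fun r _ => (hf r).continuousAt.continuousWithinAt)
      (fun r _ => (hf r).differentiableAt.differentiableWithinAt)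
      (fun r hr => by
        rw [(hf r).deriv]
        exact hC r (interior_subset hr : r ∈ Ici s))
      s (le_refl s) t hst hst
    linarith
  have hy'nonneg : ∀ s, t₁ ≤ s → 0 ≤ y' s := by
    intro s hs
    by_contra! hneg
    have hdec : ∀ r, s ≤ r → y' r ≤ y' s := by
      intro r hr
      have := mvt (C := 0) hy' (fun q hq => (hle q (hs.trans hq)).trans (by
        have := mul_nonneg hκ.le (hpos q (hs.trans hq))
        linarith)) hr
      linarith
    have hst : s ≤ s + (y s + 1) / (-y' s) := by
      have : 0 ≤ (y s + 1) / (-y' s) := div_nonneg (by linarith [hpos s hs]) (by linarith)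
      linarith
    have h2 := mvt hy hdec hst
    have h3 : y' s * (s + (y s + 1) / (-y' s) - s) = -(y s + 1) := by
      field_simp [hneg.ne]
      ring
    linarith [hpos _ (hs.trans hst)]
  have hmono : ∀ t, t₁ ≤ t → y t₁ ≤ y t := by
    intro t ht
    have := mvt (f := fun t => -y t) (C := 0) (fun t => (hy t).neg)
      (fun r hr => by linarith [hy'nonneg r hr]) ht
    linarith
  have hκy : 0 < κ * y t₁ := mul_pos hκ h₁
  have hst : t₁ ≤ t₁ + (y' t₁ + 1) / (κ * y t₁) := by
    have : 0 ≤ (y' t₁ + 1) / (κ * y t₁) :=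
      div_nonneg (by linarith [hy'nonneg t₁ le_rfl]) hκy.le
    linarith
  have h2 := mvt (C := -(κ * y t₁)) hy' (fun r hr => (hle r hr).trans (by
    have := mul_le_mul_of_nonneg_left (hmono r hr) hκ.le
    linarith)) hst
  have h3 : -(κ * y t₁) * (t₁ + (y' t₁ + 1) / (κ * y t₁) - t₁) = -(y' t₁ + 1) := by
    field_simp
    ring
  linarith [hy'nonneg _ hst]

/-- If the linearization `u'' + c u' = g'(a) u` at the rest point `a` has complex eigenvalues, that
is `c² < -4 g'(a)`, an orbit cannot tend to `a` monotonically: the function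
`y = exp(c t / 2) (w - a)` would be nonnegative with `y'' ≤ -κ y` for large times. -/
theorem not_antitone_of_sq_lt {g w v : ℝ → ℝ} {c a b g' : ℝ} (hga : g a = 0)
    (hg' : HasDerivAt g g' a) (hcg : c ^ 2 < -4 * g') (hab : a < b)
    (hw : ∀ t, HasDerivAt w (v t) t) (hv : ∀ t, HasDerivAt v (g (w t) - c * v t) t)
    (hbot : Tendsto w atBot (𝓝 b)) (htop : Tendsto w atTop (𝓝 a)) : ¬ Antitone w := by
  intro hanti
  have hwc : Continuous w := continuous_iff_continuousAt.mpr fun t => (hw t).continuousAt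
  have hwa : ∀ t, a ≤ w t := fun t => hanti.le_of_tendsto htop t
  -- a rate strictly between `c² / 4` and `-g'(a)`
  set κ : ℝ := (-g' - c ^ 2 / 4) / 2 with hκdef
  have hκ : 0 < κ := by rw [hκdef]; linarith
  obtain ⟨δ, hδ, hgδ⟩ : ∃ δ > 0, ∀ x, a ≤ x → x ≤ a + δ → g x ≤ (g' + κ) * (x - a) := by
    have := hg'.isLittleO.def hκ
    obtain ⟨r, hr, hball⟩ := Metric.eventually_nhds_iff.mp this
    refine ⟨r / 2, by positivity, fun x hax hxr => ?_⟩
    have hx := hball (y := x) (by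
      rw [Real.dist_eq, abs_of_nonneg (by linarith)]
      linarith)
    rw [hga, sub_zero, smul_eq_mul, Real.norm_eq_abs, Real.norm_eq_abs,
      abs_of_nonneg (sub_nonneg.mpr hax)] at hx
    linarith [(abs_le.mp hx).2]
  obtain ⟨t₁, ht₁⟩ : ∃ t₁, w t₁ = a + min δ ((b - a) / 2) := by
    refine mem_range_of_exists_le_of_exists_ge hwc ?_ ?_
    · have hpos : 0 < min δ ((b - a) / 2) := lt_min hδ (by linarith)
      exact ((htop.eventually_lt_const (show a < a + min δ ((b - a) / 2) by linarith)).mono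
        fun _ h => h.le).exists
    · have := min_le_right δ ((b - a) / 2)
      exact ((hbot.eventually_const_lt (show a + min δ ((b - a) / 2) < b by linarith)).mono
        fun _ h => h.le).exists
  have he : ∀ t, HasDerivAt (fun t => Real.exp (c / 2 * t)) (Real.exp (c / 2 * t) * (c / 2)) t := by
    intro t
    simpa using ((hasDerivAt_id t).const_mul (c / 2)).exp
  refine false_of_deriv_deriv_le_neg_mul (t₁ := t₁) hκ
    (y := fun t => Real.exp (c / 2 * t) * (w t - a))
    (y' := fun t => Real.exp (c / 2 * t) * (v t + c / 2 * (w t - a)))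
    (y'' := fun t => Real.exp (c / 2 * t) * (g (w t) + c ^ 2 / 4 * (w t - a))) ?_ ?_ ?_ ?_ ?_
  · intro t
    refine ((he t).mul ((hw t).sub_const a)).congr_deriv ?_
    ring
  · intro t
    refine ((he t).mul ((hv t).add (((hw t).sub_const a).const_mul (c / 2)))).congr_deriv ?_
    simp only [Pi.add_apply]
    ring
  · intro t _
    exact mul_nonneg (Real.exp_pos _).le (by linarith [hwa t])
  · refine mul_pos (Real.exp_pos _) ?_
    rw [ht₁]
    have : 0 < min δ ((b - a) / 2) := lt_min hδ (by linarith)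
    linarith
  · intro t ht
    have h1 : w t ≤ a + δ := (hanti ht).trans (by rw [ht₁]; linarith [min_le_left δ ((b - a) / 2)])
    have h2 := hgδ (w t) (hwa t) h1
    have h3 : g (w t) + c ^ 2 / 4 * (w t - a) ≤ -(κ * (w t - a)) := by
      refine (add_le_add_left h2 _).trans (le_of_eq ?_)
      rw [hκdef]
      ring
    have := mul_le_mul_of_nonneg_left h3 (Real.exp_pos (c / 2 * t)).le
    linarith

/-! ### The function `f` and the end states -/

section EndStates

variable {γ s A B : ℝ}

theorem f_eq_zero_of_constA_of_constB {P J : ℝ} (hP : 0 < P) (hA : A = constA s P J)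
    (hB : B = constB γ s P J) : f γ s A B P = 0 := by
  have := hP.ne'
  rw [f, hA, hB, constA, constB]
  field_simp
  ring

/-- The constants `A` and `B` may be computed from either end state. -/
theorem RankineHugoniot.constA_eq_constB_eq {Pm Jm Pp Jp : ℝ}
    (h : RankineHugoniot γ s Pm Jm Pp Jp) :
    constA s Pm Jm = constA s Pp Jp ∧ constB γ s Pm Jm = constB γ s Pp Jp := by
  obtain ⟨h1, h2⟩ := h
  simp only [constA, constB]
  constructor <;> linarith

theorem differentiableAt_f {P : ℝ} (hP : 0 < P) : DifferentiableAt ℝ (f γ s A B) P := by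
  unfold f
  exact ((Real.differentiableAt_rpow_const_of_ne γ hP.ne').sub_const _).add
    ((differentiableAt_const _).div differentiableAt_id hP.ne')

variable {a b : ℝ}

theorem constA_ne_zero_of_f_eq_zero (hγ : 1 ≤ γ) (ha : 0 < a) (hab : a < b)
    (hfa : f γ s A B a = 0) (hfb : f γ s A B b = 0) : A ≠ 0 := by
  rintro rfl
  have := Real.rpow_lt_rpow ha.le hab (by linarith : 0 < γ)
  simp only [f] at hfa hfb
  norm_num at hfa hfb
  linarith

theorem strictConvexOn_f (hγ : 1 ≤ γ) (hA : A ≠ 0) : StrictConvexOn ℝ (Ioi 0) (f γ s A B) := by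
  have h1 : ConvexOn ℝ (Ioi 0) (fun P : ℝ => P ^ γ - (A * s + B)) :=
    ((convexOn_rpow hγ).subset Ioi_subset_Ici_self (convex_Ioi 0)).sub
      (concaveOn_const _ (convex_Ioi 0))
  have h2 : StrictConvexOn ℝ (Ioi 0) (fun P : ℝ => A ^ 2 / P) := by
    have hA2 : 0 < A ^ 2 := by positivity
    have h3 := strictConvexOn_zpow (m := -1) (by norm_num) (by norm_num)
    refine ⟨convex_Ioi 0, fun x hx y hy hxy p q hp hq hpq => ?_⟩
    have := mul_lt_mul_of_pos_left (h3.2 hx hy hxy hp hq hpq) hA2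
    simp only [zpow_neg, zpow_one, smul_eq_mul] at this ⊢
    calc A ^ 2 / (p * x + q * y) = A ^ 2 * (p * x + q * y)⁻¹ := div_eq_mul_inv _ _
      _ < _ := this
      _ = _ := by ring
  exact h1.add_strictConvexOn h2

theorem f_neg_of_mem_Ioo (hγ : 1 ≤ γ) (ha : 0 < a) (hab : a < b)
    (hfa : f γ s A B a = 0) (hfb : f γ s A B b = 0) {P : ℝ} (hP : P ∈ Ioo a b) :
    f γ s A B P < 0 := by
  have hconv := strictConvexOn_f (s := s) (B := B) hγ
    (constA_ne_zero_of_f_eq_zero hγ ha hab hfa hfb)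
  have := hconv.lt_on_openSegment ha (ha.trans hab) hab.ne (by rwa [openSegment_eq_Ioo hab])
  rwa [hfa, hfb, max_self] at this

theorem f_pos_of_lt (hγ : 1 ≤ γ) (ha : 0 < a) (hab : a < b)
    (hfa : f γ s A B a = 0) (hfb : f γ s A B b = 0) {P : ℝ} (hP : 0 < P) (hPa : P < a) :
    0 < f γ s A B P := by
  have hconv := strictConvexOn_f (s := s) (B := B) hγ
    (constA_ne_zero_of_f_eq_zero hγ ha hab hfa hfb)
  have := hconv.lt_on_openSegment (z := a) hP (ha.trans hab) (hPa.trans hab).ne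
    (by rw [openSegment_eq_Ioo (hPa.trans hab)]; exact ⟨hPa, hab⟩)
  rw [hfa, hfb] at this
  simpa using this

theorem f_le_f_of_le_of_lt (hγ : 1 ≤ γ) (ha : 0 < a) (hab : a < b)
    (hfa : f γ s A B a = 0) (hfb : f γ s A B b = 0) {P P' : ℝ} (hP : 0 < P)
    (hPP' : P ≤ P') (hP'a : P' < a) :
    f γ s A B P' ≤ f γ s A B P := by
  have hconv := strictConvexOn_f (s := s) (B := B) hγ
    (constA_ne_zero_of_f_eq_zero hγ ha hab hfa hfb)
  have h := hconv.convexOn.le_max_of_mem_Icc (x := P) (y := a) (z := P') hP ha ⟨hPP', hP'a.le⟩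
  have hpos := f_pos_of_lt hγ ha hab hfa hfb (hP.trans_le hPP') hP'a
  rw [hfa] at h
  rcases le_max_iff.mp h with h | h
  · exact h
  · linarith

end EndStates

/-! ### The profile system in the logarithmic variable -/

/-- The force `g(w) = (2/k²) f(e^w) e^{-w}`: in terms of `w = ln P` the profile system is the linearly
damped oscillator `w'' + (2 s μ / k²) w' = g(w)`. -/
noncomputable def logForce (γ k s A B w : ℝ) : ℝ :=
  2 / k ^ 2 * f γ s A B (Real.exp w) * Real.exp (-w)

section LogForce

variable {γ μ k s A B : ℝ}

theorem contDiff_logForce {n : WithTop ℕ∞} : ContDiff ℝ n (logForce γ k s A B) := by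
  unfold logForce f
  have h1 : ContDiff ℝ n (fun w : ℝ => Real.exp w ^ γ) :=
    Real.contDiff_exp.rpow_const_of_ne fun w => (Real.exp_pos w).ne'
  have h2 : ContDiff ℝ n (fun w : ℝ => A ^ 2 / Real.exp w) :=
    contDiff_const.div Real.contDiff_exp fun w => (Real.exp_pos w).ne'
  exact (contDiff_const.mul ((h1.sub contDiff_const).add h2)).mul contDiff_neg.exp

theorem f_exp_eq (hk : 0 < k) (w : ℝ) :
    f γ s A B (Real.exp w) = k ^ 2 / 2 * (logForce γ k s A B w * Real.exp w) := by
  have : Real.exp (-w) * Real.exp w = 1 := by rw [← Real.exp_add]; simp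
  rw [logForce, mul_assoc, mul_assoc, this]
  field_simp

theorem logForce_log {P : ℝ} (hP : 0 < P) :
    logForce γ k s A B (Real.log P) = 2 / k ^ 2 * f γ s A B P / P := by
  rw [logForce, Real.exp_neg, Real.exp_log hP, ← div_eq_mul_inv]

theorem hasDerivAt_logForce_log {P : ℝ} (hP : 0 < P) (hfP : f γ s A B P = 0) :
    HasDerivAt (logForce γ k s A B) (2 / k ^ 2 * deriv (f γ s A B) P) (Real.log P) := by
  have h1 : HasDerivAt (fun w => f γ s A B (Real.exp w)) (deriv (f γ s A B) P * P)
      (Real.log P) := by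
    have := (differentiableAt_f (γ := γ) (s := s) (A := A) (B := B) hP).hasDerivAt
    rw [← Real.exp_log hP] at this
    simpa [Function.comp_def, Real.exp_log hP] using
      this.comp (Real.log P) (Real.hasDerivAt_exp (Real.log P))
  have h2 : HasDerivAt (fun w => Real.exp (-w)) (-P⁻¹) (Real.log P) := by
    simpa [Real.exp_neg, Real.exp_log hP] using (hasDerivAt_neg (Real.log P)).exp
  refine ((h1.const_mul (2 / k ^ 2)).mul h2).congr_deriv ?_
  rw [Real.exp_log hP, hfP, Real.exp_neg, Real.exp_log hP]
  field_simp
  ring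

/-- The oscillator for the force `logForce` has an orbit from `ln b` to `ln a`, where `a < b` are the
two zeros of `f`. -/
theorem exists_heteroclinic_logForce {a b c : ℝ} (hγ : 1 ≤ γ) (hk : 0 < k) (hc : 0 < c)
    (ha : 0 < a) (hab : a < b) (hfa : f γ s A B a = 0) (hfb : f γ s A B b = 0) :
    ∃ w v : ℝ → ℝ, (∀ t, HasDerivAt w (v t) t) ∧
      (∀ t, HasDerivAt v (logForce γ k s A B (w t) - c * v t) t) ∧
      Tendsto w atBot (𝓝 (Real.log b)) ∧ Tendsto v atBot (𝓝 0) ∧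
      Tendsto w atTop (𝓝 (Real.log a)) ∧ Tendsto v atTop (𝓝 0) := by
  have hb : 0 < b := ha.trans hab
  have hk2 : 0 < 2 / k ^ 2 := by positivity
  have hpos : ∀ x, x < Real.log a → 0 < logForce γ k s A B x := by
    intro x hx
    have := f_pos_of_lt hγ ha hab hfa hfb (Real.exp_pos x) ((Real.lt_log_iff_exp_lt ha).mp hx)
    exact mul_pos (mul_pos hk2 this) (Real.exp_pos _)
  have hlt : Real.log a - 1 < Real.log a := by linarith
  refine exists_heteroclinic (x₁ := Real.log a - 1) contDiff_logForce hc
    (Real.log_lt_log ha hab) ?_ hpos ?_ ?_ hlt (hpos _ hlt) ?_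
  · intro x hx
    have := f_neg_of_mem_Ioo hγ ha hab hfa hfb (P := Real.exp x)
      ⟨(Real.log_lt_iff_lt_exp ha).mp hx.1, (Real.lt_log_iff_exp_lt hb).mp hx.2⟩
    exact mul_neg_of_neg_of_pos (mul_neg_of_pos_of_neg hk2 this) (Real.exp_pos _)
  · rw [logForce_log ha, hfa]; simp
  · rw [logForce_log hb, hfb]; simp
  · intro x hx
    have h1 := f_le_f_of_le_of_lt hγ ha hab hfa hfb (Real.exp_pos x) (Real.exp_le_exp.mpr hx)
      ((Real.lt_log_iff_exp_lt ha).mp hlt)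
    have h2 := f_pos_of_lt hγ ha hab hfa hfb (Real.exp_pos _) ((Real.lt_log_iff_exp_lt ha).mp hlt)
    have h3 : Real.exp (-(Real.log a - 1)) ≤ Real.exp (-x) := Real.exp_le_exp.mpr (by linarith)
    exact mul_le_mul (mul_le_mul_of_nonneg_left h1 hk2.le) h3 (Real.exp_pos _).le
      (mul_nonneg hk2.le (h2.le.trans h1))

/-- With `P = e^w` and `w' = v` the second profile variable is `Q = (k² / 2) P' = (k² / 2) v e^w`. -/
theorem isHeteroclinic_of_log {Pm Pp : ℝ} {w v : ℝ → ℝ} (hk : 0 < k) (hPm : 0 < Pm)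
    (hPp : 0 < Pp) (hw : ∀ t, HasDerivAt w (v t) t)
    (hv : ∀ t, HasDerivAt v (logForce γ k s A B (w t) - 2 * s * μ / k ^ 2 * v t) t)
    (hwbot : Tendsto w atBot (𝓝 (Real.log Pm))) (hvbot : Tendsto v atBot (𝓝 0))
    (hwtop : Tendsto w atTop (𝓝 (Real.log Pp))) (hvtop : Tendsto v atTop (𝓝 0)) :
    IsHeteroclinic γ μ k s A B Pm Pp (fun t => Real.exp (w t))
      (fun t => k ^ 2 / 2 * (v t * Real.exp (w t))) := by
  have hP : ∀ {l : Filter ℝ} {P : ℝ}, 0 < P → Tendsto w l (𝓝 (Real.log P)) →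
      Tendsto (fun t => Real.exp (w t)) l (𝓝 P) := fun hP h => by
    have := (Real.continuous_exp.tendsto _).comp h
    rwa [Real.exp_log hP] at this
  have hQ : ∀ {l : Filter ℝ} {P : ℝ}, Tendsto (fun t => Real.exp (w t)) l (𝓝 P) →
      Tendsto v l (𝓝 0) → Tendsto (fun t => k ^ 2 / 2 * (v t * Real.exp (w t))) l (𝓝 0) :=
    fun h1 h2 => by simpa using (h2.mul h1).const_mul (k ^ 2 / 2)
  refine ⟨fun t => Real.exp_pos _, fun t => ?_, fun t => ?_, hP hPm hwbot, hQ (hP hPm hwbot) hvbot,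
    hP hPp hwtop, hQ (hP hPp hwtop) hvtop⟩
  · refine (hw t).exp.congr_deriv ?_
    field_simp
  · refine (((hv t).mul (hw t).exp).const_mul (k ^ 2 / 2)).congr_deriv ?_
    rw [f_exp_eq hk]
    have := (Real.exp_pos (w t)).ne'
    field_simp

namespace IsHeteroclinic

variable {Pm Pp : ℝ} {P Q : ℝ → ℝ}

theorem hasDerivAt_log (h : IsHeteroclinic γ μ k s A B Pm Pp P Q) (t : ℝ) :
    HasDerivAt (fun t => Real.log (P t)) (2 / k ^ 2 * Q t / P t) t :=
  (h.hasDerivAt_fst t).log (h.pos t).ne'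

theorem hasDerivAt_deriv_log (h : IsHeteroclinic γ μ k s A B Pm Pp P Q) (hk : 0 < k)
    (t : ℝ) : HasDerivAt (fun t => 2 / k ^ 2 * Q t / P t)
      (logForce γ k s A B (Real.log (P t)) - 2 * s * μ / k ^ 2 * (2 / k ^ 2 * Q t / P t)) t := by
  have hP := (h.pos t).ne'
  refine (((h.hasDerivAt_snd t).const_mul (2 / k ^ 2)).div (h.hasDerivAt_fst t) hP).congr_deriv ?_
  rw [logForce_log (h.pos t)]
  field_simp
  ring

theorem tendsto_log {l : Filter ℝ} {p : ℝ} (hp : 0 < p) (h : Tendsto P l (𝓝 p)) :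
    Tendsto (fun t => Real.log (P t)) l (𝓝 (Real.log p)) :=
  (Real.continuousAt_log hp.ne').tendsto.comp h

/-- A heteroclinic orbit that decreases to a focus cannot be monotone. -/
theorem not_antitone (h : IsHeteroclinic γ μ k s A B Pm Pp P Q) (hk : 0 < k) (hPp : 0 < Pp)
    (hlt : Pp < Pm) (hf : f γ s A B Pp = 0)
    (hfocus : (s * μ / k) ^ 2 < -2 * deriv (f γ s A B) Pp) : ¬ Antitone P := by
  intro hanti
  refine not_antitone_of_sq_lt (c := 2 * s * μ / k ^ 2) (g := logForce γ k s A B)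
    (g' := 2 / k ^ 2 * deriv (f γ s A B) Pp) (a := Real.log Pp) (b := Real.log Pm) ?_
    (hasDerivAt_logForce_log hPp hf) ?_ (Real.log_lt_log hPp hlt) h.hasDerivAt_log
    (h.hasDerivAt_deriv_log hk) (tendsto_log (hPp.trans hlt) h.tendsto_fst_atBot)
    (tendsto_log hPp h.tendsto_fst_atTop) ?_
  · rw [logForce_log hPp, hf]; simp
  · have h4 : 0 < 4 / k ^ 2 := by positivity
    have := mul_lt_mul_of_pos_left hfocus h4
    calc (2 * s * μ / k ^ 2) ^ 2 = 4 / k ^ 2 * (s * μ / k) ^ 2 := by field_simp; ring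
      _ < _ := this
      _ = _ := by ring
  · exact fun t t' htt' => Real.log_le_log (h.pos t') (hanti htt')

/-- Reversing the direction of `y` amounts to changing the signs of the speed and of `A`. -/
theorem reflect (h : IsHeteroclinic γ μ k s A B Pm Pp P Q) :
    IsHeteroclinic γ μ k (-s) (-A) B Pp Pm (fun t => P (-t)) (fun t => -Q (-t)) where
  pos t := h.pos (-t)
  hasDerivAt_fst t := by
    refine ((h.hasDerivAt_fst (-t)).comp t (hasDerivAt_neg t)).congr_deriv ?_
    ring
  hasDerivAt_snd t := by
    refine ((h.hasDerivAt_snd (-t)).comp t (hasDerivAt_neg t)).neg.congr_deriv ?_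
    simp only [f]
    ring
  tendsto_fst_atBot := h.tendsto_fst_atTop.comp tendsto_neg_atBot_atTop
  tendsto_snd_atBot := by
    simpa using (h.tendsto_snd_atTop.comp tendsto_neg_atBot_atTop).neg
  tendsto_fst_atTop := h.tendsto_fst_atBot.comp tendsto_neg_atTop_atBot
  tendsto_snd_atTop := by
    simpa using (h.tendsto_snd_atBot.comp tendsto_neg_atTop_atBot).neg

end IsHeteroclinic

theorem f_neg_neg (P : ℝ) : f γ (-s) (-A) B P = f γ s A B P := by
  simp [f]

end LogForce

/-! ### Heteroclinic orbits are profiles of traveling waves -/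

/-- Smoothness of the solutions by bootstrapping. -/
theorem contDiff_of_oscillator {g w v : ℝ → ℝ} {c : ℝ} (hg : ∀ n : ℕ, ContDiff ℝ n g)
    (hw : ∀ t, HasDerivAt w (v t) t) (hv : ∀ t, HasDerivAt v (g (w t) - c * v t) t) (n : ℕ) :
    ContDiff ℝ n w ∧ ContDiff ℝ n v := by
  induction n with
  | zero =>
    simp only [CharP.cast_eq_zero, contDiff_zero]
    exact ⟨continuous_iff_continuousAt.mpr fun t => (hw t).continuousAt,
      continuous_iff_continuousAt.mpr fun t => (hv t).continuousAt⟩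
  | succ n ih =>
    have hdw : deriv w = v := funext fun t => (hw t).deriv
    have hdv : deriv v = fun t => g (w t) - c * v t := funext fun t => (hv t).deriv
    push_cast
    rw [contDiff_succ_iff_deriv, contDiff_succ_iff_deriv, hdw, hdv]
    refine ⟨⟨fun t => (hw t).differentiableAt, by simp, ih.2⟩,
      ⟨fun t => (hv t).differentiableAt, by simp, ?_⟩⟩
    exact ((hg n).comp ih.1).sub (contDiff_const.mul ih.2)

theorem hasDerivAt_travel {φ : ℝ → ℝ} {φ' s ε t x : ℝ}
    (h : HasDerivAt φ φ' ((x - s * t) / ε)) :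
    HasDerivAt (fun y => φ ((y - s * t) / ε)) (φ' / ε) x := by
  have : HasDerivAt (fun y => (y - s * t) / ε) (1 / ε) x :=
    ((hasDerivAt_id x).sub_const (s * t)).div_const ε
  refine (h.comp x this).congr_deriv ?_
  ring

theorem hasDerivAt_travel_time {φ : ℝ → ℝ} {φ' s ε t x : ℝ}
    (h : HasDerivAt φ φ' ((x - s * t) / ε)) :
    HasDerivAt (fun τ => φ ((x - s * τ) / ε)) (-s * φ' / ε) t := by
  have : HasDerivAt (fun τ => (x - s * τ) / ε) (-s / ε) t := by
    simpa using (((hasDerivAt_id t).const_mul s).const_sub x).div_const ε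
  refine (h.comp t this).congr_deriv ?_
  ring

/-- With `w = ln P`, the flux of the momentum equation is `(k² / 2) g(w) P + s² P` up to a constant, and
the Bohm potential `(√P)'' / √P` is `w'' / 2 + w'² / 4`; the momentum equation then is the derivative
of the oscillator equation multiplied by `P`. -/
theorem IsHeteroclinic.isTravelingWave {γ μ k s A B Pm Jm Pp Jp : ℝ} {P Q : ℝ → ℝ}
    (h : IsHeteroclinic γ μ k s A B Pm Pp P Q) (hk : 0 < k) (hAm : A = constA s Pm Jm)
    (hAp : A = constA s Pp Jp) :
    IsTravelingWave γ μ k s Pm Jm Pp Jp P (fun y => s * P y - A) := by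
  have hJm : s * Pm - A = Jm := by rw [hAm, constA]; ring
  have hJp : s * Pp - A = Jp := by rw [hAp, constA]; ring
  refine ⟨fun ε hε => ?_, h.tendsto_fst_atBot, ?_, h.tendsto_fst_atTop, ?_⟩
  rotate_left
  · rw [← hJm]; exact (h.tendsto_fst_atBot.const_mul s).sub_const A
  · rw [← hJp]; exact (h.tendsto_fst_atTop.const_mul s).sub_const A
  -- the profile in the logarithmic variable
  obtain ⟨w, hwP⟩ : ∃ w : ℝ → ℝ, ∀ y, P y = Real.exp (w y) :=
    ⟨fun y => Real.log (P y), fun y => (Real.exp_log (h.pos y)).symm⟩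
  have hwlog : ∀ y, Real.log (P y) = w y := fun y => by rw [hwP, Real.log_exp]
  obtain ⟨v, hv'⟩ : ∃ v : ℝ → ℝ, ∀ y, v y = 2 / k ^ 2 * Q y / P y := ⟨_, fun _ => rfl⟩
  set g := logForce γ k s A B with hg
  set c := 2 * s * μ / k ^ 2 with hc
  have hw : ∀ y, HasDerivAt w (v y) y := fun y => by
    have := h.hasDerivAt_log y
    rw [← hv'] at this
    simpa only [hwlog] using this
  have hv : ∀ y, HasDerivAt v (g (w y) - c * v y) y := fun y => by
    have := h.hasDerivAt_deriv_log hk y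
    simpa only [hwlog, ← hv'] using this
  have hsmooth : ContDiff ℝ 3 w :=
    (contDiff_of_oscillator (fun n => contDiff_logForce) hw hv 3).1
  have hP : ∀ y, HasDerivAt P (v y * P y) y := fun y => by
    have := (hw y).exp
    simp only [← hwP] at this
    rwa [mul_comm]
  have hPsmooth : ContDiff ℝ 3 P := by
    rw [funext hwP]
    exact hsmooth.exp
  have hg' : ∀ x, HasDerivAt g (deriv g x) x := fun x =>
    ((contDiff_logForce (n := 1)).differentiable one_ne_zero x).hasDerivAt
  have hθ : ContDiff ℝ 3 (fun z : ℝ × ℝ => (z.2 - s * z.1) / ε) := by fun_prop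
  have hcdρ : ContDiff ℝ 3 (fun z : ℝ × ℝ => P ((z.2 - s * z.1) / ε)) := hPsmooth.comp hθ
  refine ⟨hcdρ, (contDiff_const.mul hcdρ).sub contDiff_const, fun t x => h.pos _, fun t x => ?_,
    fun t x => ?_⟩
  · rw [(hasDerivAt_travel_time (hP _)).deriv,
      (hasDerivAt_travel (φ := fun y => s * P y - A) (((hP _).const_mul s).sub_const A)).deriv]
    ring
  -- the flux, expressed through the force by means of the definition of `f`
  have hflux : ∀ y, (s * P y - A) ^ 2 / P y + P y ^ γ
      = k ^ 2 / 2 * (g (w y) * P y) + s ^ 2 * P y + (B - s * A) := fun y => by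
    have h1 : f γ s A B (P y) = k ^ 2 / 2 * (g (w y) * P y) := by rw [hwP, f_exp_eq hk]
    rw [← h1, f]
    have := (h.pos y).ne'
    field_simp
    ring
  have hflux' : ∀ y, HasDerivAt (fun y => (s * P y - A) ^ 2 / P y + P y ^ γ)
      (k ^ 2 / 2 * (deriv g (w y) * v y * P y + g (w y) * (v y * P y)) + s ^ 2 * (v y * P y))
      y := fun y => by
    rw [funext hflux]
    exact ((((((hg' (w y)).comp y (hw y)).mul (hP y)).const_mul (k ^ 2 / 2)).add
      ((hP y).const_mul (s ^ 2))).add_const _)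
  -- the viscous term
  have hm1 : deriv (fun y => s * P ((y - s * t) / ε) - A)
      = fun y => s * (v ((y - s * t) / ε) * P ((y - s * t) / ε)) / ε := funext fun y =>
    (hasDerivAt_travel (φ := fun y => s * P y - A) (((hP _).const_mul s).sub_const A)).deriv
  have hm2 : ∀ y, HasDerivAt (fun y => s * (v y * P y) / ε)
      (s * ((g (w y) - c * v y) * P y + v y * (v y * P y)) / ε) y := fun y =>
    (((hv y).mul (hP y)).const_mul s).div_const ε
  -- the Bohm potential: `√P = exp (w / 2)`
  have hsqrt : ∀ y, HasDerivAt (fun y => √(P y)) (v y / 2 * √(P y)) y := fun y => by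
    have hs : (fun y => √(P y)) = fun y => Real.exp (w y / 2) := funext fun y => by
      rw [hwP, Real.exp_half]
    have h1 : √(P y) = Real.exp (w y / 2) := congrFun hs y
    rw [hs, h1, mul_comm]
    exact ((hw y).div_const 2).exp
  have hsqrt2 : ∀ y, HasDerivAt (fun y => v y / 2 * √(P y) / ε)
      (((g (w y) - c * v y) / 2 + v y ^ 2 / 4) * √(P y) / ε) y := fun y =>
    ((((hv y).div_const 2).mul (hsqrt y)).div_const ε).congr_deriv (by ring)
  have hbohm1 : deriv (fun y => √(P ((y - s * t) / ε)))
      = fun y => v ((y - s * t) / ε) / 2 * √(P ((y - s * t) / ε)) / ε := funext fun y =>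
    (hasDerivAt_travel (φ := fun y => √(P y)) (hsqrt _)).deriv
  have hbohm2 : (fun y => iteratedDeriv 2 (fun y => √(P ((y - s * t) / ε))) y
        / √(P ((y - s * t) / ε)))
      = fun y => ((g (w ((y - s * t) / ε)) - c * v ((y - s * t) / ε)) / 2
          + v ((y - s * t) / ε) ^ 2 / 4) / ε / ε := funext fun y => by
    have hne : √(P ((y - s * t) / ε)) ≠ 0 := (Real.sqrt_pos.mpr (h.pos _)).ne'
    rw [iteratedDeriv_succ, iteratedDeriv_one, hbohm1,
      (hasDerivAt_travel (φ := fun y => v y / 2 * √(P y) / ε) (hsqrt2 _)).deriv]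
    field_simp
  have hbohm3 : ∀ y, HasDerivAt (fun y => ((g (w y) - c * v y) / 2 + v y ^ 2 / 4) / ε / ε)
      (((deriv g (w y) * v y - c * (g (w y) - c * v y)) / 2
        + v y * (g (w y) - c * v y) / 2) / ε / ε) y := fun y =>
    (((((((hg' (w y)).comp y (hw y)).sub ((hv y).const_mul c)).div_const 2).add
      (((hv y).pow 2).div_const 4)).div_const ε).div_const ε).congr_deriv (by
        simp only [Nat.cast_ofNat]
        ring)
  rw [(hasDerivAt_travel_time (φ := fun y => s * P y - A) (((hP _).const_mul s).sub_const A)).deriv,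
    (hasDerivAt_travel (φ := fun y => (s * P y - A) ^ 2 / P y + P y ^ γ) (hflux' _)).deriv,
    iteratedDeriv_succ, iteratedDeriv_one, hm1,
    (hasDerivAt_travel (φ := fun y => s * (v y * P y) / ε) (hm2 _)).deriv, hbohm2,
    (hasDerivAt_travel (φ := fun y => ((g (w y) - c * v y) / 2 + v y ^ 2 / 4) / ε / ε)
      (hbohm3 _)).deriv, hc]
  field_simp
  ring

/-! ### Both signs of the speed -/

theorem not_antitone_of_tendsto_of_lt {P : ℝ → ℝ} {p q : ℝ} (hbot : Tendsto P atBot (𝓝 p))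
    (htop : Tendsto P atTop (𝓝 q)) (hpq : p < q) : ¬ Antitone P := fun h =>
  hpq.not_ge ((h.le_of_tendsto htop 0).trans (h.ge_of_tendsto hbot 0))

theorem not_monotone_of_tendsto_of_lt {P : ℝ → ℝ} {p q : ℝ} (hbot : Tendsto P atBot (𝓝 p))
    (htop : Tendsto P atTop (𝓝 q)) (hqp : q < p) : ¬ Monotone P := fun h =>
  hqp.not_ge ((h.le_of_tendsto hbot 0).trans (h.ge_of_tendsto htop 0))

theorem exists_isHeteroclinic_of_pos {γ μ k s A B Pm Pp : ℝ} (hγ : 1 ≤ γ) (hμ : 0 < μ)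
    (hk : 0 < k) (hs : 0 < s) (hPp : 0 < Pp) (hlt : Pp < Pm) (hfm : f γ s A B Pm = 0)
    (hfp : f γ s A B Pp = 0) : ∃ P Q : ℝ → ℝ, IsHeteroclinic γ μ k s A B Pm Pp P Q := by
  obtain ⟨w, v, hw, hv, h1, h2, h3, h4⟩ := exists_heteroclinic_logForce (c := 2 * s * μ / k ^ 2)
    hγ hk (by positivity) hPp hlt hfp hfm
  exact ⟨_, _, isHeteroclinic_of_log hk (hPp.trans hlt) hPp hw hv h1 h2 h3 h4⟩

end QHD

theorem mainTheorem1 (γ μ k s Pm Jm Pp Jp A B : ℝ)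
    (hγ : 1 ≤ γ) (hμ : 0 < μ) (hk : 0 < k) (hPm : 0 < Pm) (hPp : 0 < Pp)
    (hRH : QHD.RankineHugoniot γ s Pm Jm Pp Jp)
    (hA : A = QHD.constA s Pm Jm) (hB : B = QHD.constB γ s Pm Jm) :
    (0 < s → Pp < Pm →
      (∀ P, 0 < P → P < Pp → QHD.F₁ γ μ k s A B Pm P ≤ 0) →
        (∃ P Q : ℝ → ℝ, QHD.IsHeteroclinic γ μ k s A B Pm Pp P Q ∧
          QHD.IsTravelingWave γ μ k s Pm Jm Pp Jp P (fun y => s * P y - A)) ∧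
        (s * μ / k < √(-2 * deriv (QHD.f γ s A B) Pp) →
          ∀ P Q : ℝ → ℝ, QHD.IsHeteroclinic γ μ k s A B Pm Pp P Q →
            ¬ Monotone P ∧ ¬ Antitone P)) ∧
    (s < 0 → Pm < Pp →
      (∀ ξ, 0 < ξ → ξ < Pm → QHD.F₁ γ μ k s A B Pp ξ ≤ 0) →
        (∃ P Q : ℝ → ℝ, QHD.IsHeteroclinic γ μ k s A B Pm Pp P Q ∧
          QHD.IsTravelingWave γ μ k s Pm Jm Pp Jp P (fun y => s * P y - A)) ∧
        (-(s * μ / k) < √(-2 * deriv (QHD.f γ s A B) Pm) →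
          ∀ P Q : ℝ → ℝ, QHD.IsHeteroclinic γ μ k s A B Pm Pp P Q →
            ¬ Monotone P ∧ ¬ Antitone P)) := by
  have hA' : A = QHD.constA s Pp Jp := hA.trans hRH.constA_eq_constB_eq.1
  have hB' : B = QHD.constB γ s Pp Jp := hB.trans hRH.constA_eq_constB_eq.2
  have hfm := QHD.f_eq_zero_of_constA_of_constB hPm hA hB
  have hfp := QHD.f_eq_zero_of_constA_of_constB hPp hA' hB'
  refine ⟨fun hs hlt _ => ⟨?_, fun hfocus P Q h => ⟨?_, ?_⟩⟩,
    fun hs hlt _ => ⟨?_, fun hfocus P Q h => ⟨fun hmono => ?_, ?_⟩⟩⟩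
  · obtain ⟨P, Q, h⟩ := QHD.exists_isHeteroclinic_of_pos hγ hμ hk hs hPp hlt hfm hfp
    exact ⟨P, Q, h, h.isTravelingWave hk hA hA'⟩
  · exact QHD.not_monotone_of_tendsto_of_lt h.tendsto_fst_atBot h.tendsto_fst_atTop hlt
  · exact h.not_antitone hk hPp hlt hfp ((Real.lt_sqrt (by positivity)).mp hfocus)
  · -- the orbit is the reflection of one with positive speed
    obtain ⟨P, Q, h⟩ := QHD.exists_isHeteroclinic_of_pos (s := -s) (A := -A) (B := B) hγ hμ hk
      (by linarith) hPm hlt (by rw [QHD.f_neg_neg, hfp]) (by rw [QHD.f_neg_neg, hfm])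
    have h' := h.reflect
    rw [neg_neg, neg_neg] at h'
    exact ⟨_, _, h', h'.isTravelingWave hk hA hA'⟩
  · have hf : QHD.f γ (-s) (-A) B = QHD.f γ s A B := funext QHD.f_neg_neg
    have hs' : 0 ≤ -(s * μ / k) := by
      have : 0 ≤ -s * μ / k := div_nonneg (mul_nonneg (by linarith) hμ.le) hk.le
      rw [neg_mul, neg_div] at this
      exact this
    refine h.reflect.not_antitone hk hPm hlt (by rw [hf, hfm]) ?_
      (fun y y' hyy' => hmono (neg_le_neg hyy'))
    rw [hf, neg_mul, neg_div]
    exact (Real.lt_sqrt hs').mp hfocus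
  · exact QHD.not_antitone_of_tendsto_of_lt h.tendsto_fst_atBot h.tendsto_fst_atTop hlt
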